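/- Let $s$ be a positive integer, let $f(M)=\sum_{n\ge 0}\lfloor M/2^n\rfloor$ for integers $M\ge 0$, and put $d=f(2s)-1$. Let $\Delta\subset\mathbb R^d$ be a $d$-dimensional lattice simplex with vertices $v_1,\dots,v_{d+1}\in\mathbb Z^d$. Suppose that $\Delta$ has degree $s$, meaning that its $h^*$-polynomial, the polynomial $h^*_\Delta(t)$ with $\sum_{n\ge 0}|n\Delta\cap\mathbb Z^d|\,t^n=h^*_\Delta(t)/(1-t)^{d+1}$, has degree $s$. Suppose also that $\Delta$ is not a lattice pyramid, meaning that it is not the image under any map $x\mapsto Ax+u$ with $A\in GL_d(\mathbb Z)$ and $u\in\mathbb Z^d$ of $\mathrm{Pyr}(P)=\mathrm{conv}\bigl(P\times\{0\}\cup\{(0,\dots,0,1)\}\bigr)\subset\mathbb R^d$ for a lattice polytope $P\subset\mathbb R^{d-1}$. Let $$\Lambda_\Delta=\Bigl\{(x_1,\dots,x_{d+1})\in(\mathbb R/\mathbb Z)^{d+1}:\ \sum_{i=1}^{d+1}x_iv_i\in\mathbb Z^d,\ \sum_{i=1}^{d+1}x_i\in\mathbb Z\Bigr\}.$$ Then $\Lambda_\Delta\subset\{0,1/2\}^{f(2s)}$,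 and $\Delta$ arises from a binary code: there is a linear subspace $C\subset\mathbb F_2^{d+1}$ such that $\Lambda_\Delta$ is the image of $C$ under the map $(a_1,\dots,a_{d+1})\mapsto(a_1/2,\dots,a_{d+1}/2)\in(\mathbb R/\mathbb Z)^{d+1}$. -/

import Mathlib

open scoped Pointwise

namespace LatticePolytope

/-- The real point of `ℝ^d` given by a point of the standard lattice `ℤ^d`. -/
def toReal {d : ℕ} (z : Fin d → ℤ) : Fin d → ℝ := fun j => (z j : ℝ)

/-- A lattice polytope in `ℝ^d`: the convex hull of a nonempty finite set of lattice points
(equivalently, a polytope all of whose vertices are lattice points). -/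
def IsLatticePolytope {d : ℕ} (P : Set (Fin d → ℝ)) : Prop :=
  ∃ S : Finset (Fin d → ℤ), S.Nonempty ∧ P = convexHull ℝ (toReal '' (S : Set (Fin d → ℤ)))

/-- Unimodular equivalence of subsets of `ℝ^d`: `Q = A P + u` with `A ∈ GL_d(ℤ)`, `u ∈ ℤ^d`. -/
def UnimodularlyEquivalent {d : ℕ} (P Q : Set (Fin d → ℝ)) : Prop :=
  ∃ (A : Matrix.GeneralLinearGroup (Fin d) ℤ) (u : Fin d → ℤ),
    Q = (fun x : Fin d → ℝ =>
      ((A : Matrix (Fin d) (Fin d) ℤ).map (Int.cast : ℤ → ℝ)).mulVec x + toReal u) '' P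

/-- `Pyr(P) = conv(P × {0} ∪ {(0, …, 0, 1)}) ⊆ ℝ^(d+1)`. -/
def pyramid {d : ℕ} (P : Set (Fin d → ℝ)) : Set (Fin (d + 1) → ℝ) :=
  convexHull ℝ ((fun α : Fin d → ℝ => (Fin.snoc α 0 : Fin (d + 1) → ℝ)) '' P ∪
    {(Fin.snoc (0 : Fin d → ℝ) 1 : Fin (d + 1) → ℝ)})

/-- `Q ⊆ ℝ^d` is a lattice pyramid: up to unimodular equivalence it is `Pyr(P)` for some
lattice polytope `P ⊆ ℝ^(d-1)`. -/
def IsLatticePyramid : {d : ℕ} → Set (Fin d → ℝ) → Prop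
  | 0, _ => False
  | d + 1, Q => ∃ P : Set (Fin d → ℝ), IsLatticePolytope P ∧ UnimodularlyEquivalent (pyramid P) Q

/-- The number of lattice points `|nP ∩ ℤ^d|` of the `n`-th dilate of `P`. -/
noncomputable def latticePointCount {d : ℕ} (P : Set (Fin d → ℝ)) (n : ℕ) : ℕ :=
  Set.ncard {z : Fin d → ℤ | toReal z ∈ (n : ℝ) • P}

/-- The Ehrhart series `∑_{n ≥ 0} |nP ∩ ℤ^d| t^n`. -/
noncomputable def ehrhartSeries {d : ℕ} (P : Set (Fin d → ℝ)) : PowerSeries ℤ :=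
  PowerSeries.mk fun n => (latticePointCount P n : ℤ)

/-- `h` is the `h^*`-polynomial of the `d`-dimensional lattice polytope `P ⊆ ℝ^d`:
the Ehrhart series of `P` is `h(t) / (1 - t)^(d+1)`. Such an `h` is unique. -/
def IsHStarPolynomial {d : ℕ} (P : Set (Fin d → ℝ)) (h : Polynomial ℤ) : Prop :=
  (1 - PowerSeries.X) ^ (d + 1) * ehrhartSeries P = (h : PowerSeries ℤ)

/-- The `d`-dimensional lattice polytope `P ⊆ ℝ^d` has degree `s`: its `h^*`-polynomial
has degree `s`. -/
def HasDegree {d : ℕ} (P : Set (Fin d → ℝ)) (s : ℕ) : Prop :=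
  ∃ h : Polynomial ℤ, IsHStarPolynomial P h ∧ h.degree = s

/-- A lattice simplex of dimension `d` in `ℝ^d`, with an ordering of its vertices. -/
structure LatticeSimplex (d : ℕ) where
  vertex : Fin (d + 1) → Fin d → ℤ
  affineIndependent : AffineIndependent ℝ fun i => toReal (vertex i)

/-- The simplex itself, as a subset of `ℝ^d`. -/
def LatticeSimplex.toSet {d : ℕ} (Δ : LatticeSimplex d) : Set (Fin d → ℝ) :=
  convexHull ℝ (Set.range fun i => toReal (Δ.vertex i))

/-- The group `Λ_Δ` of all `x ∈ (ℝ/ℤ)^(d+1)` with `∑ x_i v_i ∈ ℤ^d` and `∑ x_i ∈ ℤ`.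
Membership in `ℤ` is vanishing in `ℝ/ℤ`; see `LatticeSimplex.coe_mem_Lam_iff` for the
formulation with real representatives. -/
def LatticeSimplex.Lam {d : ℕ} (Δ : LatticeSimplex d) :
    AddSubgroup (Fin (d + 1) → UnitAddCircle) where
  carrier := {x | (∀ j : Fin d, ∑ i, Δ.vertex i j • x i = 0) ∧ ∑ i, x i = 0}
  zero_mem' := by simp
  add_mem' := by
    rintro x y ⟨hx, hx'⟩ ⟨hy, hy'⟩
    refine ⟨fun j => ?_, ?_⟩
    · simp [Finset.sum_add_distrib, hx j, hy j]
    · simp [Finset.sum_add_distrib, hx', hy']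
  neg_mem' := by
    rintro x ⟨hx, hx'⟩
    refine ⟨fun j => ?_, ?_⟩
    · simp [hx j]
    · simp [hx']

theorem coe_sum_eq_zero_iff {ι : Type*} (s : Finset ι) (y : ι → ℝ) :
    ∑ i ∈ s, (y i : UnitAddCircle) = 0 ↔ ∃ n : ℤ, ∑ i ∈ s, y i = n := by
  have h : ∑ i ∈ s, (y i : UnitAddCircle) = ((∑ i ∈ s, y i : ℝ) : UnitAddCircle) :=
    (map_sum (QuotientAddGroup.mk' (AddSubgroup.zmultiples (1 : ℝ))) y s).symm
  rw [h, AddCircle.coe_eq_zero_iff]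
  constructor
  · rintro ⟨n, hn⟩
    exact ⟨n, by simpa using hn.symm⟩
  · rintro ⟨n, hn⟩
    exact ⟨n, by simpa using hn.symm⟩

theorem LatticeSimplex.coe_mem_Lam_iff {d : ℕ} (Δ : LatticeSimplex d) (y : Fin (d + 1) → ℝ) :
    (fun i => (y i : UnitAddCircle)) ∈ Δ.Lam ↔
      (∃ z : Fin d → ℤ, ∑ i, y i • toReal (Δ.vertex i) = toReal z) ∧ ∃ n : ℤ, ∑ i, y i = n := by
  have key : ∀ j : Fin d, ∑ i, Δ.vertex i j • (y i : UnitAddCircle) = 0 ↔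
      ∃ n : ℤ, ∑ i, y i * (Δ.vertex i j : ℝ) = n := by
    intro j
    rw [← coe_sum_eq_zero_iff]
    have : ∀ i, Δ.vertex i j • (y i : UnitAddCircle)
        = ((y i * (Δ.vertex i j : ℝ) : ℝ) : UnitAddCircle) := by
      intro i
      rw [← AddCircle.coe_zsmul, zsmul_eq_mul, mul_comm]
    simp only [this]
  change ((∀ j : Fin d, ∑ i, Δ.vertex i j • (y i : UnitAddCircle) = 0) ∧
    ∑ i, (y i : UnitAddCircle) = 0) ↔ _
  rw [coe_sum_eq_zero_iff]
  refine and_congr_left fun _ => ?_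
  simp only [key]
  rw [Classical.skolem]
  refine exists_congr fun z => ?_
  rw [funext_iff]
  refine forall_congr' fun j => ?_
  simp [toReal, Finset.sum_apply]

/-- `f(M) = ∑_{n ≥ 0} ⌊M / 2^n⌋`; the terms with `n > ⌊log₂ M⌋` vanish. -/
def f (M : ℕ) : ℕ := ∑ n ∈ Finset.range (Nat.log 2 M + 1), M / 2 ^ n

theorem f_eq_finsum (M : ℕ) : f M = ∑ᶠ n : ℕ, M / 2 ^ n := by
  refine (finsum_eq_sum_of_support_subset _ fun n hn => ?_).symm
  by_contra h
  simp only [Finset.coe_range, Set.mem_Iio, not_lt] at h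
  exact hn (Nat.div_eq_of_lt (Nat.lt_pow_of_log_lt (by norm_num) h))

/-- The map `g : 𝔽₂^m → (ℝ/ℤ)^m`, `(a_1, …, a_m) ↦ (a_1/2, …, a_m/2)`. -/
noncomputable def binaryEmbedding {m : ℕ} (a : Fin m → ZMod 2) : Fin m → UnitAddCircle :=
  fun i => ZMod.toAddCircle (a i)

/-- `Δ` arises from a binary code: `Λ_Δ = g(C)` for a linear subspace `C ⊆ 𝔽₂^(d+1)`. -/
def LatticeSimplex.ArisesFromBinaryCode {d : ℕ} (Δ : LatticeSimplex d) : Prop :=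
  ∃ C : Submodule (ZMod 2) (Fin (d + 1) → ZMod 2),
    (Δ.Lam : Set (Fin (d + 1) → UnitAddCircle)) =
      binaryEmbedding '' (C : Set (Fin (d + 1) → ZMod 2))

end LatticePolytope

namespace LatticePolytope

/-! The geometry enters only through two facts about `Λ_Δ`. The coefficients of `h^*` count the
points of the half-open parallelepiped over `Δ` by height, so representatives in `[0, 1)` of an
element of `Λ_Δ` sum to at most `s`; adding the bounds for `x` and `-x` gives at most `2s` nonzero
coordinates (`weight_le`). If a coordinate vanished on all of `Λ_Δ`, then `Δ` would be a lattice
pyramid over the opposite facet (`isLatticePyramid_of_forall_eq_zero`).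

The rest is coding theory over an arbitrary abelian group. A group with no identically zero
coordinate and all weights at most `M` has length at most `f M`: delete the support of a word of
maximal weight, which at least halves the maximal weight (`card_le_f_of_weight_le`). At length `f (2
* s)` every inequality is tight. This forces words of weight `2 * s` to be killed by `2`
(`add_self_eq_zero_of_weight_eq`), and such words lie in no proper subgroup
(`exists_weight_eq_notMem`), so the whole group has exponent two. -/

theorem f_zero : f 0 = 0 := by simp [f]

theorem f_eq_add_half (M : ℕ) : f M = M + f (M / 2) := by
  rw [f_eq_finsum, f_eq_finsum]
  have h1 := finsum_eq_sum_of_support_subset (s := Finset.range (M + 1))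
    (fun n : ℕ => M / 2 ^ n) (fun n hn => by
      by_contra h
      simp only [Finset.coe_range, Set.mem_Iio, not_lt] at h
      exact hn (Nat.div_eq_of_lt (lt_of_lt_of_le (by omega) Nat.lt_two_pow_self.le)))
  have h2 := finsum_eq_sum_of_support_subset (s := Finset.range M)
    (fun n : ℕ => M / 2 / 2 ^ n) (fun n hn => by
      by_contra h
      simp only [Finset.coe_range, Set.mem_Iio, not_lt] at h
      have : n < 2 ^ n := Nat.lt_two_pow_self
      exact hn (Nat.div_eq_of_lt (by omega)))
  rw [h1, h2, Finset.sum_range_succ']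
  simp [Nat.div_div_eq_div_mul, pow_succ']
  ring

theorem f_strictMono : StrictMono f := by
  refine strictMono_nat_of_lt_succ fun n => ?_
  induction n using Nat.strong_induction_on with
  | _ n ih =>
    rcases Nat.eq_zero_or_pos n with rfl | hn
    · rw [f_zero, f_eq_add_half 1]; omega
    · rw [f_eq_add_half n, f_eq_add_half (n + 1)]
      have : f (n / 2) ≤ f ((n + 1) / 2) := by
        rcases (by omega : (n + 1) / 2 = n / 2 ∨ (n + 1) / 2 = n / 2 + 1) with h | h
        · rw [h]
        · rw [h]; exact (ih _ (by omega)).le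
      omega

/-! ### Residual codes and the extremal length -/

section Weight

variable {ι T : Type*} [AddCommGroup T]

open scoped Classical in
/-- The number of nonzero coordinates of `g` in `I`. -/
noncomputable def weight (I : Finset ι) (g : ι → T) : ℕ := (I.filter fun i => g i ≠ 0).card

/-- The coordinates of `I` on which `x` vanishes. -/
noncomputable def residual (I : Finset ι) (x : ι → T) : Finset ι :=
  open scoped Classical in I.filter fun i => x i = 0

theorem card_residual_add_weight (I : Finset ι) (x : ι → T) :
    (residual I x).card + weight I x = I.card := by
  classical
  exact Finset.card_filter_add_card_filter_not _

theorem weight_eq_sum [DecidableEq T] (I : Finset ι) (g : ι → T) :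
    weight I g = ∑ i ∈ I, if g i = 0 then 0 else 1 := by
  classical
  rw [weight, Finset.card_filter]
  exact Finset.sum_congr rfl fun i _ => by split_ifs <;> simp_all

/-- Coordinatewise: off the support of `x`, the words `y` and `y + x` agree; on it, they cannot both
vanish. -/
theorem two_mul_weight_residual_add_le (I : Finset ι) (x y : ι → T) :
    2 * weight (residual I x) y + weight I x ≤ weight I y + weight I (y + x) := by
  classical
  rw [weight_eq_sum, residual, Finset.sum_filter, weight_eq_sum, weight_eq_sum, weight_eq_sum,
    Finset.mul_sum, ← Finset.sum_add_distrib, ← Finset.sum_add_distrib]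
  refine Finset.sum_le_sum fun i _ => ?_
  by_cases hx : x i = 0 <;> by_cases hy : y i = 0 <;> simp [hx, hy]

/-- In the equality case of `two_mul_weight_residual_add_le`, exactly one of `y` and `y + x`
vanishes at each coordinate in the support of `x`. -/
theorem eq_zero_or_add_eq_zero (I : Finset ι) (x y : ι → T)
    (h : weight I y + weight I (y + x) ≤ 2 * weight (residual I x) y + weight I x)
    {i : ι} (hi : i ∈ I) (hx : x i ≠ 0) : y i = 0 ∨ y i + x i = 0 := by
  classical
  by_contra! hne
  refine absurd h (not_le.2 ?_)
  rw [weight_eq_sum, residual, Finset.sum_filter, weight_eq_sum, weight_eq_sum, weight_eq_sum,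
    Finset.mul_sum, ← Finset.sum_add_distrib, ← Finset.sum_add_distrib]
  refine Finset.sum_lt_sum (fun i _ => ?_) ⟨i, hi, ?_⟩
  · by_cases hx : x i = 0 <;> by_cases hy : y i = 0 <;> simp [hx, hy]
  · simp [hx, hne.1, hne.2]

theorem weight_residual_add (I : Finset ι) (x y : ι → T) :
    weight (residual I x) (y + x) = weight (residual I x) y := by
  classical
  unfold weight residual
  congr 1
  refine Finset.filter_congr fun i hi => ?_
  rw [Finset.mem_filter] at hi
  simp [hi.2]

theorem residual_subset (I : Finset ι) (x : ι → T) : residual I x ⊆ I := by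
  classical
  exact Finset.filter_subset _ _

theorem weight_pos (I : Finset ι) {x : ι → T} {i : ι} (hi : i ∈ I) (hx : x i ≠ 0) :
    0 < weight I x := by
  classical
  exact Finset.card_pos.2 ⟨i, by simp [hi, hx]⟩

theorem exists_weight_max (G : AddSubgroup (ι → T)) (I : Finset ι) :
    ∃ x ∈ G, ∀ g ∈ G, weight I g ≤ weight I x := by
  classical
  have hfin : (weight I '' (G : Set (ι → T))).Finite :=
    (Finset.range (I.card + 1)).finite_toSet.subset (by
      rintro _ ⟨g, -, rfl⟩
      have := card_residual_add_weight I g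
      simp only [Finset.coe_range, Set.mem_Iio]
      omega)
  obtain ⟨_, ⟨x, hx, rfl⟩, hmax⟩ := hfin.exists_maximal ⟨_, 0, G.zero_mem, rfl⟩
  exact ⟨x, hx, fun g hg => (le_total _ _).elim id fun h => hmax ⟨g, hg, rfl⟩ h⟩

/-- For `x` of maximal weight `w`, the residual inequality bounds weights off the support of `x` by
`w / 2`. Induction gives length at most `w + f (w / 2) = f w`. -/
theorem card_le_f_of_weight_le (G : AddSubgroup (ι → T)) (M : ℕ) (I : Finset ι)
    (hI : ∀ i ∈ I, ∃ g ∈ G, g i ≠ 0) (hM : ∀ g ∈ G, weight I g ≤ M) : I.card ≤ f M := by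
  induction M using Nat.strong_induction_on generalizing I with
  | _ M ih =>
    rcases I.eq_empty_or_nonempty with rfl | ⟨i, hi⟩
    · simp
    obtain ⟨x, hx, hmax⟩ := exists_weight_max G I
    obtain ⟨g, hg, hgi⟩ := hI i hi
    have hpos : 0 < weight I x := (weight_pos I hi hgi).trans_le (hmax g hg)
    have hres := ih (weight I x / 2) (by have := hM x hx; omega) (residual I x)
      (fun j hj => hI j (residual_subset I x hj)) (fun y hy => by
        have h1 := two_mul_weight_residual_add_le I x y
        have h2 := hmax y hy
        have h3 := hmax (y + x) (G.add_mem hy hx)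
        omega)
    have h1 := card_residual_add_weight I x
    have h2 := f_eq_add_half (weight I x)
    have h3 := f_strictMono.monotone (hM x hx)
    omega

/-- A maximal weight below `M` would bound the length by a smaller value of the strictly increasing
`f`. -/
theorem exists_weight_eq (G : AddSubgroup (ι → T)) (M : ℕ) (I : Finset ι)
    (hI : ∀ i ∈ I, ∃ g ∈ G, g i ≠ 0) (hM : ∀ g ∈ G, weight I g ≤ M) (hcard : I.card = f M) :
    ∃ x ∈ G, weight I x = M := by
  obtain ⟨x, hx, hmax⟩ := exists_weight_max G I
  have := card_le_f_of_weight_le G _ I hI hmax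
  rw [hcard] at this
  exact ⟨x, hx, le_antisymm (hM x hx) (f_strictMono.le_iff_le.1 this)⟩

/-- In the extremal case, the elements of maximal weight lie in no proper subgroup. -/
theorem exists_weight_eq_notMem (G G' : AddSubgroup (ι → T)) {z : ι → T} (hz : z ∈ G)
    (hz' : z ∉ G') (M : ℕ) (I : Finset ι)
    (hI : ∀ i ∈ I, ∃ g ∈ G, g i ≠ 0) (hM : ∀ g ∈ G, weight I g ≤ M) (hcard : I.card = f M) :
    ∃ x ∈ G, x ∉ G' ∧ weight I x = M := by
  induction M using Nat.strong_induction_on generalizing I with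
  | _ M ih =>
    rcases Nat.eq_zero_or_pos M with rfl | hpos
    · exact ⟨z, hz, hz', Nat.le_zero.1 (hM z hz)⟩
    obtain ⟨x, hx, hxM⟩ := exists_weight_eq G M I hI hM hcard
    by_cases hxG : x ∈ G'
    swap
    · exact ⟨x, hx, hxG, hxM⟩
    obtain ⟨y, hy, hyG, hyM⟩ := ih (M / 2) (by omega) (residual I x)
      (fun j hj => hI j (residual_subset I x hj)) (fun y hy => by
        have h1 := two_mul_weight_residual_add_le I x y
        have h2 := hM y hy
        have h3 := hM (y + x) (G.add_mem hy hx)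
        omega)
      (by
        have h1 := card_residual_add_weight I x
        have h2 := f_eq_add_half M
        omega)
    have h1 := two_mul_weight_residual_add_le I x y
    have h2 := hM y hy
    have h3 := hM (y + x) (G.add_mem hy hx)
    -- The two weights sum to at least `2 * (M / 2) + M ≥ 2 * M - 1`, and neither exceeds `M`; the
    -- rounding for odd `M` is harmless.
    rcases (by omega : weight I y = M ∨ weight I (y + x) = M) with h | h
    · exact ⟨y, hy, hyG, h⟩
    · exact ⟨y + x, G.add_mem hy hx, fun h' => hyG ((G'.add_mem_cancel_right hxG).1 h'), h⟩

/-- The residual of `x` is again extremal, of length `f s`, so some `y` has residual weight `s`. As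
`2 * s` is even, nothing is lost to rounding: the residual inequality is tight for `y` and for its
translates by `x`, which have the same residual weight. Comparing two translates at `i` gives the
claim. -/
theorem add_self_eq_zero_of_weight_eq (G : AddSubgroup (ι → T)) {s : ℕ} (I : Finset ι)
    (hI : ∀ i ∈ I, ∃ g ∈ G, g i ≠ 0) (hM : ∀ g ∈ G, weight I g ≤ 2 * s)
    (hcard : I.card = f (2 * s)) {x : ι → T} (hx : x ∈ G) (hxM : weight I x = 2 * s)
    {i : ι} (hi : i ∈ I) : x i + x i = 0 := by
  by_cases hxi : x i = 0
  · simp [hxi]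
  have hpos : 0 < weight I x := weight_pos I hi hxi
  obtain ⟨y, hy, hys⟩ := exists_weight_eq G s (residual I x)
    (fun j hj => hI j (residual_subset I x hj)) (fun y hy => by
      have h1 := two_mul_weight_residual_add_le I x y
      have h2 := hM y hy
      have h3 := hM (y + x) (G.add_mem hy hx)
      omega)
    (by
      have h1 := card_residual_add_weight I x
      have h2 := f_eq_add_half (2 * s)
      rw [Nat.mul_div_cancel_left s two_pos] at h2
      omega)
  have key : ∀ y' ∈ G, weight (residual I x) y' = s → y' i = 0 ∨ y' i + x i = 0 :=
    fun y' hy' hs' => eq_zero_or_add_eq_zero I x y' (by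
      have h2 := hM y' hy'
      have h3 := hM (y' + x) (G.add_mem hy' hx)
      omega) hi hxi
  -- On the support of `x`, a word of residual weight `s` takes only the values `0` and `-x i`. If
  -- `y i = 0`, then `y + x` has the value `x i`; if `y i = -x i`, then `y - x` has the value `-2 x
  -- i`.
  rcases key y hy hys with h | h
  · rcases key (y + x) (G.add_mem hy hx) (by rw [weight_residual_add, hys]) with h' | h'
    · exact absurd (by simpa [h] using h') hxi
    · simpa [h] using h'
  · have hw : weight (residual I x) (y - x) = s := by
      rw [← hys, ← weight_residual_add I x (y - x), sub_add_cancel]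
    have hyi : y i = - x i := eq_neg_of_add_eq_zero_left h
    rcases key (y - x) (G.sub_mem hy hx) hw with h' | h'
    · rw [Pi.sub_apply, hyi, ← neg_add', neg_eq_zero] at h'
      exact h'
    · exact absurd (by simpa [hyi] using h') hxi

/-- A group of vectors of even maximal weight `2 s` and of the extremal length `f (2 s)`
has exponent two. -/
theorem add_self_eq_zero_of_card_eq [Fintype ι] (G : AddSubgroup (ι → T)) {s : ℕ}
    (hI : ∀ i, ∃ g ∈ G, g i ≠ 0) (hM : ∀ g ∈ G, weight Finset.univ g ≤ 2 * s)
    (hcard : Fintype.card ι = f (2 * s)) {z : ι → T} (hz : z ∈ G) : z + z = 0 := by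
  let G' : AddSubgroup (ι → T) := (2 • AddMonoidHom.id (ι → T)).ker
  have hG' : ∀ g, g ∈ G' ↔ g + g = 0 := fun g => by
    simp [G', AddMonoidHom.mem_ker, two_nsmul]
  by_contra hne
  obtain ⟨x, hx, hx', hxM⟩ := exists_weight_eq_notMem G G' hz (fun h => hne ((hG' z).1 h)) (2 * s)
    Finset.univ (fun i _ => hI i) hM hcard
  refine hx' ((hG' x).2 (funext fun i => ?_))
  exact add_self_eq_zero_of_weight_eq G Finset.univ (fun i _ => hI i) hM hcard hx hxM
    (Finset.mem_univ i)

end Weight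

/-! ### The `h^*`-polynomial of a simplex and the weight bound -/

theorem toReal_injective {d : ℕ} : Function.Injective (toReal : (Fin d → ℤ) → Fin d → ℝ) :=
  fun _ _ h => funext fun j => Int.cast_injective (congrFun h j)

theorem toReal_sub {d : ℕ} (a b : Fin d → ℤ) : toReal (a - b) = toReal a - toReal b :=
  funext fun j => by simp [toReal]

theorem toReal_add {d : ℕ} (a b : Fin d → ℤ) : toReal (a + b) = toReal a + toReal b :=
  funext fun j => by simp [toReal]

namespace LatticeSimplex

variable {d : ℕ} (Δ : LatticeSimplex d)

theorem eq_of_sum_smul_eq {y y' : Fin (d + 1) → ℝ} (h : ∑ i, y i = ∑ i, y' i)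
    (h' : ∑ i, y i • toReal (Δ.vertex i) = ∑ i, y' i • toReal (Δ.vertex i)) : y = y' := by
  have := affineIndependent_iff.1 Δ.affineIndependent Finset.univ (y - y')
    (by simp [h]) (by simp [sub_smul, h'])
  exact funext fun i => sub_eq_zero.1 (this i (Finset.mem_univ i))

theorem mem_toSet_iff {p : Fin d → ℝ} : p ∈ Δ.toSet ↔
    ∃ w : Fin (d + 1) → ℝ, (∀ i, 0 ≤ w i) ∧ ∑ i, w i = 1 ∧
      ∑ i, w i • toReal (Δ.vertex i) = p := by
  classical
  rw [toSet]
  constructor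
  · intro hp
    have hlin : toReal ∘ Δ.vertex = fun i => Fintype.linearCombination ℝ
        (fun i => toReal (Δ.vertex i)) (Pi.single i 1) := by
      funext i
      simp
    rw [show (fun i => toReal (Δ.vertex i)) = _ from hlin, Set.range_comp', ←
      LinearMap.image_convexHull, convexHull_rangle_single_eq_stdSimplex] at hp
    obtain ⟨w, ⟨hw, hw1⟩, rfl⟩ := hp
    exact ⟨w, hw, hw1, by rw [Fintype.linearCombination_apply]⟩
  · rintro ⟨w, hw, hw1, rfl⟩
    exact mem_convexHull_of_exists_fintype w _ hw hw1 (fun i => ⟨i, rfl⟩) rfl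

/-- The points of height `n` in the cone over `Δ`, given by their coordinates with respect to the
vertices, that project to lattice points and whose coordinates in `S` are less than `1`. -/
def conePoints (S : Finset (Fin (d + 1))) (n : ℕ) : Set (Fin (d + 1) → ℝ) :=
  {y | (∀ i, 0 ≤ y i) ∧ (∀ i ∈ S, y i < 1) ∧ ∑ i, y i = n ∧
    ∃ z : Fin d → ℤ, ∑ i, y i • toReal (Δ.vertex i) = toReal z}

theorem injOn_conePoints (n : ℕ) :
    Set.InjOn (fun y : Fin (d + 1) → ℝ => ∑ i, y i • toReal (Δ.vertex i))
      (Δ.conePoints ∅ n) :=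
  fun _ hy _ hy' h => Δ.eq_of_sum_smul_eq (hy.2.2.1.trans hy'.2.2.1.symm) h

theorem image_conePoints (n : ℕ) :
    (fun y : Fin (d + 1) → ℝ => ∑ i, y i • toReal (Δ.vertex i)) '' Δ.conePoints ∅ n =
      toReal '' {z : Fin d → ℤ | toReal z ∈ (n : ℝ) • Δ.toSet} := by
  ext p
  constructor
  · rintro ⟨y, ⟨hy, -, hn, z, hz⟩, rfl⟩
    refine ⟨z, ?_, hz.symm⟩
    rw [Set.mem_ofPred_eq, Set.mem_smul_set]
    -- Division by `n` fails at height `0`; there any point of `Δ` serves as witness.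
    rcases Nat.eq_zero_or_pos n with rfl | hpos
    · have h0 : ∀ i, y i = 0 := fun i =>
        (Finset.sum_eq_zero_iff_of_nonneg fun i _ => hy i).1 (by simpa using hn) i
          (Finset.mem_univ i)
      refine ⟨toReal (Δ.vertex 0), subset_convexHull ℝ _ ⟨0, rfl⟩, ?_⟩
      rw [← hz]
      simp [h0]
    · have hn0 : (n : ℝ) ≠ 0 := by positivity
      refine ⟨∑ i, (y i / n) • toReal (Δ.vertex i), Δ.mem_toSet_iff.2
        ⟨fun i => y i / n, fun i => div_nonneg (hy i) n.cast_nonneg, ?_, rfl⟩, ?_⟩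
      · rw [← Finset.sum_div, hn, div_self hn0]
      · rw [← hz, Finset.smul_sum]
        exact Finset.sum_congr rfl fun i _ => by rw [smul_smul, mul_div_cancel₀ _ hn0]
  · rintro ⟨z, hz, rfl⟩
    obtain ⟨p, hp, hpz⟩ := Set.mem_smul_set.1 hz
    obtain ⟨w, hw, hw1, rfl⟩ := Δ.mem_toSet_iff.1 hp
    have hsum : ∑ i, ((n : ℝ) * w i) • toReal (Δ.vertex i) = toReal z := by
      rw [← hpz, Finset.smul_sum]
      exact Finset.sum_congr rfl fun i _ => by rw [smul_smul]
    exact ⟨fun i => n * w i, ⟨fun i => mul_nonneg n.cast_nonneg (hw i), by simp,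
      by rw [← Finset.mul_sum, hw1, mul_one], z, hsum⟩, hsum⟩

theorem latticePointCount_toSet (n : ℕ) :
    latticePointCount Δ.toSet n = (Δ.conePoints ∅ n).ncard := by
  rw [latticePointCount, ← Set.ncard_image_of_injective _ toReal_injective, ← image_conePoints,
    (Δ.injOn_conePoints n).ncard_image]

/-- Needed because `Set.ncard` takes the default value `0` on infinite sets. -/
theorem finite_conePoints (S : Finset (Fin (d + 1))) (n : ℕ) : (Δ.conePoints S n).Finite := by
  have hb : Bornology.IsBounded ((n : ℝ) • Δ.toSet) :=
    (((Set.finite_range _).isCompact_convexHull ℝ).smul _).isBounded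
  obtain ⟨R, hR⟩ := hb.exists_norm_le
  have hfin : {z : Fin d → ℤ | toReal z ∈ (n : ℝ) • Δ.toSet}.Finite := by
    refine (Set.finite_Icc (fun _ => -⌈R⌉ : Fin d → ℤ) (fun _ => ⌈R⌉)).subset fun z hz => ?_
    have h : ∀ j, |(z j : ℝ)| ≤ ⌈R⌉ := fun j =>
      ((norm_le_pi_norm (toReal z) j).trans (hR _ hz)).trans (Int.le_ceil R)
    have h' : ∀ j, |z j| ≤ ⌈R⌉ := fun j => by exact_mod_cast h j
    exact ⟨fun j => (abs_le.1 (h' j)).1, fun j => (abs_le.1 (h' j)).2⟩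
  have h0 : (Δ.conePoints ∅ n).Finite :=
    Set.Finite.of_finite_image (by rw [image_conePoints]; exact hfin.image _)
      (Δ.injOn_conePoints n)
  exact h0.subset fun y hy => ⟨hy.1, by simp, hy.2.2⟩

theorem conePoints_insert_zero (S : Finset (Fin (d + 1))) (i : Fin (d + 1)) :
    Δ.conePoints (insert i S) 0 = Δ.conePoints S 0 := by
  ext y
  refine ⟨fun h => ⟨h.1, fun j hj => h.2.1 j (Finset.mem_insert_of_mem hj), h.2.2⟩,
    fun h => ⟨h.1, fun j _ => ?_, h.2.2⟩⟩
  rw [(Finset.sum_eq_zero_iff_of_nonneg fun i _ => h.1 i).1 (by simpa using h.2.2.1) j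
    (Finset.mem_univ j)]
  exact one_pos

/-- A point either has `y i < 1`, or subtracting the vertex `i` moves it down one level within the
cone. -/
theorem ncard_conePoints_succ {S : Finset (Fin (d + 1))} {i : Fin (d + 1)} (hi : i ∉ S) (n : ℕ) :
    (Δ.conePoints S (n + 1)).ncard =
      (Δ.conePoints (insert i S) (n + 1)).ncard + (Δ.conePoints S n).ncard := by
  have hinj : Function.Injective fun y : Fin (d + 1) → ℝ => y + Pi.single i 1 :=
    add_left_injective _
  rw [← Set.ncard_image_of_injective (Δ.conePoints S n) hinj,
    ← Set.ncard_union_eq ?_ (Δ.finite_conePoints _ _) ((Δ.finite_conePoints _ _).image _)]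
  · congr 1
    ext y
    constructor
    · rintro ⟨h0, h1, h2, z, hz⟩
      rcases lt_or_ge (y i) 1 with hy | hy
      · refine Or.inl ⟨h0, fun j hj => ?_, h2, z, hz⟩
        rcases Finset.mem_insert.1 hj with rfl | hj
        exacts [hy, h1 j hj]
      · refine Or.inr ⟨y - Pi.single i 1, ⟨fun j => ?_, fun j hj => ?_, ?_, z - Δ.vertex i, ?_⟩,
          sub_add_cancel _ _⟩
        · rcases eq_or_ne j i with rfl | hj
          · simpa using hy
          · simpa [hj] using h0 j
        · simpa [ne_of_mem_of_not_mem hj hi] using h1 j hj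
        · simp [h2]
        · simp [sub_smul, hz, toReal_sub, Pi.single_apply]
    · rintro (⟨h0, h1, h2⟩ | ⟨y, ⟨h0, h1, h2, z, hz⟩, rfl⟩)
      · exact ⟨h0, fun j hj => h1 j (Finset.mem_insert_of_mem hj), h2⟩
      · refine ⟨fun j => ?_, fun j hj => ?_, ?_, z + Δ.vertex i, ?_⟩
        · exact add_nonneg (h0 j) ((Pi.single_nonneg.2 zero_le_one : (0 : Fin (d + 1) → ℝ) ≤ _) j)
        · simpa [ne_of_mem_of_not_mem hj hi] using h1 j hj
        · simp [Finset.sum_add_distrib, h2]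
        · simp [add_smul, Finset.sum_add_distrib, hz, toReal_add, Pi.single_apply]
  · rw [Set.disjoint_left]
    rintro _ ⟨-, h1, -⟩ ⟨y, ⟨h0, -⟩, rfl⟩
    have := h1 i (Finset.mem_insert_self i S)
    have := h0 i
    simp only [Pi.add_apply, Pi.single_eq_same] at *
    linarith

/-- Each factor `1 - X` truncates one coordinate. For `S = univ` the left side is `h^*`, whose
coefficients are thus counts. -/
theorem one_sub_X_pow_mul_ehrhartSeries (S : Finset (Fin (d + 1))) :
    (1 - PowerSeries.X) ^ S.card * ehrhartSeries Δ.toSet =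
      PowerSeries.mk fun n => ((Δ.conePoints S n).ncard : ℤ) := by
  induction S using Finset.induction_on with
  | empty => simp [ehrhartSeries, latticePointCount_toSet]
  | insert i S hi ih =>
    rw [Finset.card_insert_of_notMem hi, pow_succ', mul_assoc, ih]
    ext n
    rcases n with _ | n
    · simp [sub_mul, conePoints_insert_zero]
    · rw [sub_mul, one_mul, map_sub, PowerSeries.coeff_succ_X_mul]
      simp [Δ.ncard_conePoints_succ hi n]

theorem le_of_mem_conePoints {s m : ℕ} (hdeg : HasDegree Δ.toSet s) {y : Fin (d + 1) → ℝ}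
    (hy : y ∈ Δ.conePoints Finset.univ m) : m ≤ s := by
  obtain ⟨h, hh, hs⟩ := hdeg
  have key := Δ.one_sub_X_pow_mul_ehrhartSeries Finset.univ
  rw [Finset.card_univ, Fintype.card_fin, hh] at key
  have hm := congrArg (PowerSeries.coeff m) key
  rw [Polynomial.coeff_coe, PowerSeries.coeff_mk] at hm
  have hpos := (Set.ncard_pos (Δ.finite_conePoints _ m)).2 ⟨y, hy⟩
  have hne : h.coeff m ≠ 0 := by rw [hm]; exact_mod_cast hpos.ne'
  exact_mod_cast hs ▸ Polynomial.le_degree_of_ne_zero hne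

theorem coe_fract (r : ℝ) : ((Int.fract r : ℝ) : UnitAddCircle) = r := by
  rw [Int.fract, AddCircle.coe_sub, sub_eq_self, AddCircle.coe_eq_zero_iff]
  exact ⟨⌊r⌋, by simp⟩

theorem sum_fract_le {s : ℕ} (hdeg : HasDegree Δ.toSet s) {y : Fin (d + 1) → ℝ}
    (hy : (fun i => (y i : UnitAddCircle)) ∈ Δ.Lam) : ∑ i, Int.fract (y i) ≤ s := by
  have hy' : (fun i => ((Int.fract (y i) : ℝ) : UnitAddCircle)) ∈ Δ.Lam := by
    simpa only [coe_fract] using hy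
  obtain ⟨hz, n, hn⟩ := (Δ.coe_mem_Lam_iff _).1 hy'
  have h0 : (0 : ℝ) ≤ n := hn ▸ Finset.sum_nonneg fun i _ => Int.fract_nonneg _
  lift n to ℕ using (by exact_mod_cast h0)
  rw [hn]
  exact_mod_cast Δ.le_of_mem_conePoints hdeg (m := n)
    ⟨fun i => Int.fract_nonneg (y i), fun i _ => Int.fract_lt_one _, by simpa using hn, hz⟩

theorem weight_le {s : ℕ} (hdeg : HasDegree Δ.toSet s) {x : Fin (d + 1) → UnitAddCircle}
    (hx : x ∈ Δ.Lam) : weight Finset.univ x ≤ 2 * s := by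
  classical
  have hrep : ∀ i, ∃ r : ℝ, (r : UnitAddCircle) = x i := fun i =>
    QuotientAddGroup.mk_surjective (x i)
  choose y hy using hrep
  obtain rfl : (fun i => (y i : UnitAddCircle)) = x := funext hy
  have h1 := Δ.sum_fract_le hdeg hx
  have h2 := Δ.sum_fract_le hdeg (y := -y) (by simpa [Pi.neg_def] using Δ.Lam.neg_mem hx)
  -- The fractional parts of `r` and `-r` sum to `1`, or to `0` when `r` is an integer.
  have h3 : (weight Finset.univ (fun i => (y i : UnitAddCircle)) : ℝ) =
      ∑ i, (Int.fract (y i) + Int.fract (-y i)) := by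
    rw [weight_eq_sum, Nat.cast_sum]
    refine Finset.sum_congr rfl fun i _ => ?_
    have hiff : (y i : UnitAddCircle) = 0 ↔ Int.fract (y i) = 0 := by
      rw [AddCircle.coe_eq_zero_iff, Int.fract_eq_zero_iff]
      simp [Set.mem_range]
    by_cases h : Int.fract (y i) = 0
    · simp [hiff.2 h, h, Int.fract_neg_eq_zero.2 h]
    · simp [hiff.not.2 h, Int.fract_neg h]
  rw [Finset.sum_add_distrib] at h3
  have : (weight Finset.univ (fun i => (y i : UnitAddCircle)) : ℝ) ≤ 2 * s := by
    rw [h3, two_mul]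
    exact add_le_add h1 h2
  exact_mod_cast this

end LatticeSimplex

/-! ### Identically zero coordinates and lattice pyramids -/

/-- A linear functional on `ℤ^(n+1)` with value `1` at `w` is the last coordinate for some basis
with last basis vector `w`. -/
theorem exists_linearEquiv_last {n : ℕ} (a : (Fin (n + 1) → ℤ) →ₗ[ℤ] ℤ) {w : Fin (n + 1) → ℤ}
    (hw : a w = 1) : ∃ B : (Fin (n + 1) → ℤ) ≃ₗ[ℤ] (Fin (n + 1) → ℤ),
      (∀ z, B z (Fin.last n) = a z) ∧ B w = Fin.snoc (0 : Fin n → ℤ) 1 := by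
  have hsurj : Function.Surjective a := fun m => ⟨m • w, by simp [-zsmul_eq_mul, hw]⟩
  have hrank : Module.finrank ℤ (LinearMap.ker a) = n := by
    have h1 := Submodule.finrank_quotient_add_finrank (LinearMap.ker a)
    rw [(a.quotKerEquivOfSurjective hsurj).finrank_eq, Module.finrank_self,
      Module.finrank_fin_fun] at h1
    omega
  let e : LinearMap.ker a ≃ₗ[ℤ] (Fin n → ℤ) :=
    (Module.finBasisOfFinrankEq ℤ (LinearMap.ker a) hrank).equivFun
  -- Since `a w = 1`, the lattice splits as `ker a ⊕ ℤ w`; this is the projection to the first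
  -- summand.
  let p : (Fin (n + 1) → ℤ) →ₗ[ℤ] LinearMap.ker a :=
    (LinearMap.id - a.smulRight w).codRestrict _ fun z => by simp [-zsmul_eq_mul, hw]
  have hp : ∀ z, (p z : Fin (n + 1) → ℤ) = z - a z • w := fun z => rfl
  let B : (Fin (n + 1) → ℤ) ≃ₗ[ℤ] (Fin (n + 1) → ℤ) :=
    { toFun := fun z => Fin.snoc (e (p z)) (a z)
      map_add' := fun x y => by
        funext i
        refine Fin.lastCases ?_ (fun i => ?_) i <;> simp
      map_smul' := fun c x => by
        funext i
        refine Fin.lastCases ?_ (fun i => ?_) i <;> simp [-zsmul_eq_mul]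
      invFun := fun x => (e.symm (Fin.init x) : Fin (n + 1) → ℤ) + x (Fin.last n) • w
      left_inv := fun z => by simp [hp]
      right_inv := fun x => by
        have h0 : a (e.symm (Fin.init x) : Fin (n + 1) → ℤ) = 0 := (e.symm (Fin.init x)).2
        have h1 : p ((e.symm (Fin.init x) : Fin (n + 1) → ℤ) + x (Fin.last n) • w) =
            e.symm (Fin.init x) := by
          ext1
          simp [-zsmul_eq_mul, hp, h0, hw]
        simp only [h1]
        simp [-zsmul_eq_mul, h0, hw] }
  refine ⟨B, fun z => Fin.snoc_last (α := fun _ => ℤ) (a z) (e (p z)), ?_⟩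
  have h1 : p w = 0 := by
    ext1
    simp [hp, hw]
  change (Fin.snoc (e (p w)) (a w) : Fin (n + 1) → ℤ) = _
  rw [h1, hw, map_zero]

/-- The invertible integer matrix of a linear automorphism of `ℤ^n`. -/
def glOfLinearEquiv {n : ℕ} (B : (Fin n → ℤ) ≃ₗ[ℤ] (Fin n → ℤ)) :
    Matrix.GeneralLinearGroup (Fin n) ℤ where
  val := LinearMap.toMatrix' B.toLinearMap
  inv := LinearMap.toMatrix' B.symm.toLinearMap
  val_inv := by rw [← LinearMap.toMatrix'_comp]; simp
  inv_val := by rw [← LinearMap.toMatrix'_comp]; simp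

theorem glOfLinearEquiv_mulVec_toReal {n : ℕ} (B : (Fin n → ℤ) ≃ₗ[ℤ] (Fin n → ℤ))
    (z : Fin n → ℤ) :
    ((glOfLinearEquiv B : Matrix (Fin n) (Fin n) ℤ).map (Int.cast : ℤ → ℝ)).mulVec (toReal z) =
      toReal (B z) := by
  have h : (glOfLinearEquiv B : Matrix (Fin n) (Fin n) ℤ).mulVec z = B z :=
    LinearMap.toMatrix'_mulVec _ _
  rw [← h]
  funext j
  exact (RingHom.map_mulVec (Int.castRingHom ℝ) _ z j).symm

theorem pyramid_convexHull {n : ℕ} (T : Set (Fin n → ℝ)) :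
    pyramid (convexHull ℝ T) =
      convexHull ℝ ((fun α : Fin n → ℝ => (Fin.snoc α 0 : Fin (n + 1) → ℝ)) '' T ∪
        {(Fin.snoc (0 : Fin n → ℝ) 1 : Fin (n + 1) → ℝ)}) := by
  let F : (Fin n → ℝ) →ₗ[ℝ] (Fin (n + 1) → ℝ) :=
    { toFun := fun α => Fin.snoc α 0
      map_add' := fun x y => by
        funext i
        refine Fin.lastCases ?_ (fun i => ?_) i <;> simp
      map_smul' := fun c x => by
        funext i
        refine Fin.lastCases ?_ (fun i => ?_) i <;> simp }
  have hF := F.image_convexHull T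
  change (fun α : Fin n → ℝ => (Fin.snoc α 0 : Fin (n + 1) → ℝ)) '' _ =
    convexHull ℝ ((fun α : Fin n → ℝ => (Fin.snoc α 0 : Fin (n + 1) → ℝ)) '' T) at hF
  rw [pyramid, hF, convexHull_convexHull_union_left]

theorem toReal_eq_snoc {n : ℕ} (q : Fin (n + 1) → ℤ) :
    toReal q = Fin.snoc (toReal (Fin.init q)) (q (Fin.last n) : ℝ) := by
  funext i
  refine Fin.lastCases ?_ (fun i => ?_) i <;> simp [toReal, Fin.init]

theorem image_affine_convexHull {n : ℕ} (A : Matrix (Fin n) (Fin n) ℝ) (u : Fin n → ℝ)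
    (T : Set (Fin n → ℝ)) :
    (fun x => A.mulVec x + u) '' convexHull ℝ T =
      convexHull ℝ ((fun x => A.mulVec x + u) '' T) :=
  AffineMap.image_convexHull (A.mulVecLin.toAffineMap + AffineMap.const ℝ (Fin n → ℝ) u) T

namespace LatticeSimplex

/-- The vertices of a lattice simplex as an affine basis. -/
noncomputable def affineBasis {d : ℕ} (Δ : LatticeSimplex d) :
    AffineBasis (Fin (d + 1)) ℝ (Fin d → ℝ) :=
  ⟨fun i => toReal (Δ.vertex i), Δ.affineIndependent,
    Δ.affineIndependent.affineSpan_eq_top_iff_card_eq_finrank_add_one.2 (by simp)⟩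

theorem affineBasis_apply {d : ℕ} (Δ : LatticeSimplex d) (i : Fin (d + 1)) :
    Δ.affineBasis i = toReal (Δ.vertex i) := rfl

/-- The barycentric coordinates of a lattice point, taken modulo `1`, form an element of `Λ_Δ`. -/
theorem exists_int_coord_eq {d : ℕ} (Δ : LatticeSimplex d) {i : Fin (d + 1)}
    (hi : ∀ x ∈ Δ.Lam, x i = 0) (z : Fin d → ℤ) :
    ∃ m : ℤ, Δ.affineBasis.coord i (toReal z) = m := by
  have h := hi (fun k => (Δ.affineBasis.coord k (toReal z) : UnitAddCircle))
    ((Δ.coe_mem_Lam_iff _).2 ⟨⟨z, Δ.affineBasis.linear_combination_coord_eq_self (toReal z)⟩, 1, by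
      rw [Δ.affineBasis.sum_coord_apply_eq_one, Int.cast_one]⟩)
  obtain ⟨m, hm⟩ := (AddCircle.coe_eq_zero_iff _).1 h
  exact ⟨m, by simpa using hm.symm⟩

/-- The barycentric coordinate `i` is integral on the lattice. It is `0` on the facet opposite
vertex `i` and `1` at that vertex, so it serves as the height of a pyramid. -/
theorem isLatticePyramid_of_forall_eq_zero {n : ℕ} (Δ : LatticeSimplex (n + 1))
    {i : Fin (n + 2)} (hi : ∀ x ∈ Δ.Lam, x i = 0) : IsLatticePyramid Δ.toSet := by
  classical
  -- A vertex of the opposite facet becomes the origin, so that the affine coordinate becomes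
  -- linear.
  obtain ⟨j, hj⟩ := exists_ne i
  let φ := (Δ.affineBasis.coord i).linear
  have hφ : ∀ p q, φ (toReal p - toReal q) =
      Δ.affineBasis.coord i (toReal p) - Δ.affineBasis.coord i (toReal q) := fun p q =>
    AffineMap.linearMap_vsub _ _ _
  have hint : ∀ z : Fin (n + 1) → ℤ, ∃ m : ℤ, φ (toReal z) = m := fun z => by
    obtain ⟨m, hm⟩ := Δ.exists_int_coord_eq hi (z + Δ.vertex j)
    refine ⟨m, ?_⟩
    have h := hφ (z + Δ.vertex j) (Δ.vertex j)
    rw [← affineBasis_apply, AffineBasis.coord_apply_ne _ hj.symm, hm, affineBasis_apply,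
      toReal_add, add_sub_cancel_right, sub_zero] at h
    exact h
  choose a' ha' using hint
  let a : (Fin (n + 1) → ℤ) →ₗ[ℤ] ℤ := AddMonoidHom.toIntLinearMap
    (AddMonoidHom.mk' a' fun x y => by
      have : ((a' (x + y) : ℤ) : ℝ) = (a' x + a' y : ℤ) := by
        rw [← ha', toReal_add, map_add, ha', ha', Int.cast_add]
      exact_mod_cast this)
  have ha : ∀ z, (a z : ℝ) = φ (toReal z) := fun z => (ha' z).symm
  have hav : ∀ k, (a (Δ.vertex k - Δ.vertex j) : ℝ) = if i = k then 1 else 0 := fun k => by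
    rw [ha, toReal_sub, hφ, ← affineBasis_apply, ← affineBasis_apply, AffineBasis.coord_apply,
      AffineBasis.coord_apply_ne _ hj.symm, sub_zero]
  have hai : a (Δ.vertex i - Δ.vertex j) = 1 := by exact_mod_cast (hav i).trans (if_pos rfl)
  obtain ⟨B, hB, hBw⟩ := exists_linearEquiv_last a hai
  let q : Fin (n + 2) → Fin (n + 1) → ℤ := fun k => B (Δ.vertex k - Δ.vertex j)
  have hq : ∀ k, ((glOfLinearEquiv B.symm : Matrix (Fin (n + 1)) (Fin (n + 1)) ℤ).map
      (Int.cast : ℤ → ℝ)).mulVec (toReal (q k)) + toReal (Δ.vertex j) = toReal (Δ.vertex k) := by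
    intro k
    rw [glOfLinearEquiv_mulVec_toReal, B.symm_apply_apply, toReal_sub, sub_add_cancel]
  have hqi : (Fin.snoc (0 : Fin n → ℝ) 1 : Fin (n + 1) → ℝ) = toReal (q i) := by
    rw [show q i = _ from hBw, toReal_eq_snoc, Fin.init_snoc, Fin.snoc_last]
    congr 1
    · funext k
      simp [toReal]
    · simp
  have hqk : ∀ k, k ≠ i →
      (Fin.snoc (toReal (Fin.init (q k))) 0 : Fin (n + 1) → ℝ) = toReal (q k) := by
    intro k hk
    have h0 : ((q k (Fin.last n) : ℤ) : ℝ) = 0 := by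
      rw [show q k (Fin.last n) = _ from hB _, hav, if_neg hk.symm]
    rw [toReal_eq_snoc (q k), h0]
  refine ⟨_, ⟨(Finset.univ.erase i).image fun k => Fin.init (q k), ⟨Fin.init (q j), ?_⟩, rfl⟩,
    glOfLinearEquiv B.symm, Δ.vertex j, ?_⟩
  · exact Finset.mem_image_of_mem _ (by simp [hj])
  · rw [pyramid_convexHull, image_affine_convexHull, toSet]
    congr 1
    rw [Set.image_union, Set.image_singleton, hqi, hq]
    ext p
    constructor
    · rintro ⟨k, rfl⟩
      by_cases hk : k = i
      · exact Or.inr (by rw [hk]; rfl)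
      · refine Or.inl ⟨_, ⟨_, ⟨Fin.init (q k), ?_, rfl⟩, rfl⟩, ?_⟩
        · exact Finset.mem_coe.2 (Finset.mem_image_of_mem _ (by simp [hk]))
        · simp only [hqk k hk, hq]
    · rintro (⟨_, ⟨_, ⟨z, hz, rfl⟩, rfl⟩, rfl⟩ | rfl)
      · obtain ⟨k, hk, rfl⟩ := Finset.mem_image.1 (Finset.mem_coe.1 hz)
        have hk' : k ≠ i := (Finset.mem_erase.1 hk).1
        exact ⟨k, by simp only [hqk k hk', hq]⟩
      · exact ⟨i, rfl⟩

end LatticeSimplex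

/-! ### From exponent two to a binary code -/

theorem eq_zero_or_eq_half {t : UnitAddCircle} (ht : t + t = 0) :
    t = 0 ∨ t = ((1 / 2 : ℝ) : UnitAddCircle) := by
  obtain ⟨r, rfl⟩ := QuotientAddGroup.mk_surjective t
  change ((r : UnitAddCircle) + (r : UnitAddCircle) = 0) at ht
  rw [← AddCircle.coe_add, AddCircle.coe_eq_zero_iff] at ht
  obtain ⟨m, hm⟩ := ht
  have hm' : (m : ℝ) = r + r := by simpa using hm
  rcases Int.even_or_odd' m with ⟨k, rfl | rfl⟩
  · left
    refine (AddCircle.coe_eq_zero_iff _).2 ⟨k, ?_⟩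
    push_cast at hm'
    simp only [zsmul_eq_mul, mul_one]
    linarith
  · right
    have hr : r = 1 / 2 + k := by
      push_cast at hm'
      linarith
    change (r : UnitAddCircle) = _
    rw [hr, AddCircle.coe_add, add_eq_left]
    exact (AddCircle.coe_eq_zero_iff _).2 ⟨k, by simp⟩

theorem LatticeSimplex.arisesFromBinaryCode_of_forall {d : ℕ} (Δ : LatticeSimplex d)
    (h : ∀ x ∈ Δ.Lam, ∀ i, x i = 0 ∨ x i = ((1 / 2 : ℝ) : UnitAddCircle)) :
    Δ.ArisesFromBinaryCode := by
  classical
  let F : (Fin (d + 1) → ZMod 2) →+ (Fin (d + 1) → UnitAddCircle) :=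
    { toFun := binaryEmbedding
      map_zero' := funext fun i => by simp [binaryEmbedding]
      map_add' := fun x y => funext fun i => by simp [binaryEmbedding] }
  -- Every additive subgroup of an `𝔽₂`-space is a subspace, so the preimage of `Λ_Δ` is a code.
  refine ⟨AddSubgroup.toZModSubmodule 2 (Δ.Lam.comap F), ?_⟩
  rw [AddSubgroup.coe_toZModSubmodule]
  refine subset_antisymm (fun x hx => ?_) (by rintro _ ⟨a, ha, rfl⟩; exact ha)
  have hx' : binaryEmbedding (fun i => if x i = 0 then (0 : ZMod 2) else 1) = x := by
    funext i
    by_cases h0 : x i = 0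
    · simp [binaryEmbedding, h0]
    · have h1 := ZMod.toAddCircle_natCast (N := 2) 1
      rw [Nat.cast_one] at h1
      simp only [binaryEmbedding, h0, if_false, h1]
      rw [(h x hx i).resolve_left h0]
      norm_num
  refine ⟨_, ?_, hx'⟩
  change binaryEmbedding _ ∈ Δ.Lam
  rwa [hx']

end LatticePolytope

theorem theorem1p3 (s d : ℕ) (hs : 0 < s) (hd : d + 1 = LatticePolytope.f (2 * s))
    (Δ : LatticePolytope.LatticeSimplex d)
    (hdeg : LatticePolytope.HasDegree Δ.toSet s)
    (hpyr : ¬ LatticePolytope.IsLatticePyramid Δ.toSet) :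
    Δ.ArisesFromBinaryCode ∧
      ∀ x ∈ Δ.Lam, ∀ i, x i = 0 ∨ x i = ((1 / 2 : ℝ) : UnitAddCircle) := by
  have hactive : ∀ i, ∃ x ∈ Δ.Lam, x i ≠ 0 := by
    -- In dimension `0` nothing counts as a lattice pyramid, so this case must be excluded; `f (2 *
    -- s) ≥ 2 * s ≥ 2` does so.
    have hd0 : d ≠ 0 := by
      have := LatticePolytope.f_eq_add_half (2 * s)
      omega
    obtain ⟨n, rfl⟩ := Nat.exists_eq_succ_of_ne_zero hd0
    intro i
    by_contra! hi
    exact hpyr (Δ.isLatticePyramid_of_forall_eq_zero hi)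
  have hhalf : ∀ x ∈ Δ.Lam, ∀ i, x i = 0 ∨ x i = ((1 / 2 : ℝ) : UnitAddCircle) :=
    fun x hx i => LatticePolytope.eq_zero_or_eq_half (congrFun
      (LatticePolytope.add_self_eq_zero_of_card_eq Δ.Lam hactive (fun g hg => Δ.weight_le hdeg hg)
        (by rw [Fintype.card_fin, hd]) hx) i)
  exact ⟨Δ.arisesFromBinaryCode_of_forall hhalf, hhalf⟩
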